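/- **Theorem (pessimistic agents).** *Model.* There are two arms with mean rewards $\mu_1,\mu_2\in[0,1]$. Initially, $N_0$ independent samples of each arm $a\in\{1,2\}$ are drawn from the Bernoulli distribution with mean $\mu_a$ and are made available to all agents. In each round $t=1,\dots,T$ (with $T\ge 1$), agent $t$ observes the history (the initial samples and the arm-reward pairs of agents $1,\dots,t-1$), computes an index for each arm, and chooses an arm $a_t$ with the largest index, ties being broken independently and uniformly at random; then a reward is drawn independently from the Bernoulli distribution with mean $\mu_{a_t}$, and the pair is added to the history. Agent $t$ is *$\eta_t$-pessimistic*, $\eta_t\ge 0$, if its index of each arm $a$ is $\max\{0,\ \hat\mu_{a,t}-\sqrt{\eta_t/n_{a,t}}\}$, where $n_{a,t}$ and $\hat\mu_{a,t}$ are the number of samples of arm $a$ in the observed history (including the initial samples) and their average reward. The *$0$-sampling failure* is the event that all $T$ agents choose arm $2$. Let $\Delta=\mu_1-\mu_2$ and $\mathrm{Regret}(T)=T\max(\mu_1,\mu_2)-\mathbb E\big[\sum_{t=1}^T\mu_{a_t}\big]$. *Claim.* For every $c\in(0,\tfrac12)$ there are constants $C>0$ and $K>0$, depending only on $c$, such that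 the following holds for all $T\ge 1$, $N_0$, $\mu_1,\mu_2$ and $\eta_1,\dots,\eta_T\ge0$. Suppose each agent $t$ is $\eta_t$-pessimistic, put $\eta=\max_{1\le t\le T}\eta_t$, and assume $$c<\mu_2<\mu_1<1-c,\qquad N_0\ \ge\ 64\,\eta/c^2+1/c .$$ Then $$\Pr[\text{$0$-sampling failure}]\ \ge\ C\,\Delta\,e^{-K N_0\Delta^2} \qquad\text{and}\qquad \mathrm{Regret}(T)\ \ge\ C\,\Delta^2\,T\,e^{-K N_0\Delta^2}.$$ (In particular, $\mathrm{Regret}(T)\ge C\,\Delta^2\,e^{-K N_0\Delta^2}$.) -/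

import Mathlib

noncomputable section

namespace BanditSocialLearning

/-- A data point `(a, r)`: the arm `a` that was sampled and the realized reward, where `true`
stands for reward `1` and `false` for reward `0`. -/
abbrev DataPoint : Type := Fin 2 × Bool

/-- Arm `1`. -/
abbrev arm1 : Fin 2 := 0

/-- Arm `2`. -/
abbrev arm2 : Fin 2 := 1

/-- The numerical value of a reward. -/
def rewardValue (r : Bool) : ℝ := if r then 1 else 0

/-- A history: the initial data, followed by the arm-reward pairs of the previous agents in
chronological order. -/
structure History where
  initial : List DataPoint
  rounds : List DataPoint

namespace History

instance : MeasurableSpace History := ⊤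

/-- All data points of a history. -/
def data (h : History) : List DataPoint := h.initial ++ h.rounds

/-- The number of samples of arm `a` in the history, including the initial data. -/
def count (h : History) (a : Fin 2) : ℕ := (h.data.filter (fun x => x.1 = a)).length

/-- The average reward of arm `a` in the history, including the initial data. -/
def avg (h : History) (a : Fin 2) : ℝ :=
  ((h.data.filter (fun x => x.1 = a)).map (fun x => rewardValue x.2)).sum / (h.count a : ℝ)

/-- The truncated lower confidence bound `max {0, avg - √(η / n)}` of arm `a`. -/
def lcb (η : ℝ) (h : History) (a : Fin 2) : ℝ :=
  max 0 (h.avg a - Real.sqrt (η / (h.count a : ℝ)))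

end History

/-- The index rule of an agent: the index of each arm, given the observed history. -/
abbrev IndexRule : Type := History → Fin 2 → ℝ

/-- An `η`-pessimistic agent sets the index of each arm to its lower confidence bound. -/
def IsPessimistic (η : ℝ) (ind : IndexRule) : Prop :=
  ∀ (h : History) (a : Fin 2), ind h a = h.lcb η a

/-- The arms with the largest index. -/
def bestArms (v : Fin 2 → ℝ) : Finset (Fin 2) :=
  open Classical in Finset.univ.filter (fun a => ∀ b, v b ≤ v a)

theorem bestArms_nonempty (v : Fin 2 → ℝ) : (bestArms v).Nonempty := by
  classical
  obtain ⟨a, ha⟩ := Finite.exists_max v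
  exact ⟨a, by simpa [bestArms] using ha⟩

/-- The arm chosen given the indices: uniformly at random among the arms with the largest
index. -/
def chooseArm (v : Fin 2 → ℝ) : PMF (Fin 2) :=
  PMF.uniformOfFinset (bestArms v) (bestArms_nonempty v)

/-- The Bernoulli reward with mean `p`. -/
def rewardLaw (p : unitInterval) : PMF Bool :=
  PMF.ofFintype (fun r => ENNReal.ofReal (if r then (p : ℝ) else 1 - (p : ℝ))) (by
    have h0 : (0 : ℝ) ≤ p := p.2.1
    have h1 : (0 : ℝ) ≤ 1 - p := sub_nonneg.2 p.2.2
    simp [← ENNReal.ofReal_add h0 h1])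

/-- The law of `n` independent samples of an arm `a` with mean reward `p`. -/
def sampleArm (p : unitInterval) (a : Fin 2) : ℕ → PMF (List DataPoint)
  | 0 => PMF.pure []
  | n + 1 => (rewardLaw p).bind fun r => (sampleArm p a n).bind fun l => PMF.pure ((a, r) :: l)

/-- The law of the initial history: `N₀` independent samples of each arm, no rounds yet. -/
def initialLaw (μ : Fin 2 → unitInterval) (N₀ : ℕ) : PMF History :=
  (sampleArm (μ arm1) arm1 N₀).bind fun l₁ =>
    (sampleArm (μ arm2) arm2 N₀).bind fun l₂ =>
      PMF.pure { initial := l₁ ++ l₂, rounds := [] }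

/-- One round: an agent with index rule `ind` observes `h` and chooses an arm `a`, a Bernoulli
reward with mean `μ a` is drawn, and the new data point is added to the history. -/
def playRound (μ : Fin 2 → unitInterval) (ind : IndexRule) (h : History) : PMF History :=
  (chooseArm (ind h)).bind fun a =>
    (rewardLaw (μ a)).bind fun r =>
      PMF.pure { initial := h.initial, rounds := h.rounds ++ [(a, r)] }

/-- The law of the history after the first `T` agents `1, …, T` have acted, where `agents t`
is the index rule of agent `t` (the values `agents 0` and `agents t`, `t > T`, are not used). -/
def protocolLaw (μ : Fin 2 → unitInterval) (N₀ : ℕ) (agents : ℕ → IndexRule) : ℕ → PMF History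
  | 0 => initialLaw μ N₀
  | T + 1 => (protocolLaw μ N₀ agents T).bind (playRound μ (agents (T + 1)))

/-- The `n`-sampling failure (arm `2` being the bad arm): all but at most `n` agents choose
arm `2`. -/
def samplingFailure (n : ℕ) : Set History :=
  {h | (h.rounds.filter (fun x => x.1 ≠ arm2)).length ≤ n}

/-- The probability of the `n`-sampling failure among agents `1, …, T`. -/
def failureProb (μ : Fin 2 → unitInterval) (N₀ : ℕ) (agents : ℕ → IndexRule) (T n : ℕ) : ℝ :=
  (protocolLaw μ N₀ agents T).toMeasure.real (samplingFailure n)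

/-- `Regret(T) = μ* T - E[∑_{t ≤ T} μ_{a_t}]`, with `μ* = max μ₁ μ₂`. -/
def regret (μ : Fin 2 → unitInterval) (N₀ : ℕ) (agents : ℕ → IndexRule) (T : ℕ) : ℝ :=
  max (μ arm1 : ℝ) (μ arm2 : ℝ) * T -
    ∫ h, (h.rounds.map (fun x => (μ x.1 : ℝ))).sum ∂(protocolLaw μ N₀ agents T).toMeasure

end BanditSocialLearning

end

open scoped ENNReal

namespace BanditSocialLearning

/-! An unlucky start causes the failure. Fix a threshold `θ` below `μ₂` by a constant multiple of
`Δ`. Suppose the initial average of arm 1 is at most `θ` and the running average of arm 2 stays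
above `θ` from the first round on. Arm 1 has no more samples than arm 2, so its deduction `√(η/n)`
is at least as large, and arm 2 wins strictly (`History.IsStuck.lcb_lt`); `N₀` is large enough that
truncation at `0` creates no tie.

The two events concern different arms, hence independent samples. The first has probability at least
a constant times `exp (-K N₀ Δ²)`: under a mean just below `θ` it is likely, and Cauchy-Schwarz
transfers this to the true mean (`binomialExp_lower_tail`). The second is survival of a walk with
drift of order `Δ`: an exponential supermartingale gives probability of order `Δ` (`survival_step`,
`binomialExp_survival_ge`).

Adaptivity is handled by a potential on histories that vanishes off the failure event and does not
decrease in expectation in any round (`potential_le_pmfExp_playRound`). Its initial expectation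
therefore bounds the failure probability from below. Each failure costs regret `Δ T` (`regret_ge`).
-/

/-! ### Expectations under discrete laws. -/

/-- The expectation of an extended nonnegative function under a discrete law. -/
noncomputable def pmfExp {α : Type*} (p : PMF α) (f : α → ℝ≥0∞) : ℝ≥0∞ := ∑' x, p x * f x

theorem pmfExp_pure {α : Type*} (a : α) (f : α → ℝ≥0∞) : pmfExp (PMF.pure a) f = f a := by
  classical
  rw [pmfExp, tsum_eq_single a]
  · simp
  · intro b hb
    simp [hb]

theorem pmfExp_bind {α β : Type*} (p : PMF α) (g : α → PMF β) (f : β → ℝ≥0∞) :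
    pmfExp (p.bind g) f = pmfExp p fun a => pmfExp (g a) f := by
  simp only [pmfExp, PMF.bind_apply, ← ENNReal.tsum_mul_right, ← ENNReal.tsum_mul_left]
  rw [ENNReal.tsum_comm]
  simp only [mul_assoc]

theorem pmfExp_mono {α : Type*} (p : PMF α) {f g : α → ℝ≥0∞} (h : ∀ a, f a ≤ g a) :
    pmfExp p f ≤ pmfExp p g :=
  ENNReal.tsum_le_tsum fun a => mul_le_mul_right (h a) _

theorem pmfExp_le_toMeasure {α : Type*} [MeasurableSpace α] (p : PMF α) {f : α → ℝ≥0∞}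
    {s : Set α} (hs : MeasurableSet s) (h1 : ∀ a, f a ≤ 1) (h0 : ∀ a, a ∉ s → f a = 0) :
    pmfExp p f ≤ p.toMeasure s := by
  rw [PMF.toMeasure_apply p hs]
  refine ENNReal.tsum_le_tsum fun a => ?_
  by_cases ha : a ∈ s
  · simpa [ha] using mul_le_mul_right (h1 a) (p a)
  · simp [ha, h0 a ha]

theorem pmfExp_rewardLaw (p : unitInterval) (f : Bool → ℝ≥0∞) :
    pmfExp (rewardLaw p) f
      = ENNReal.ofReal p * f true + ENNReal.ofReal (1 - p) * f false := by
  simp [pmfExp, rewardLaw, tsum_fintype]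

/-! ### Binomial expectations and the lower tail. -/

/-- The expectation of `f (x + S)`, where `S` is binomial with parameters `n` and `p`. -/
noncomputable def binomialExp (p : ℝ) : ℕ → (ℝ → ℝ) → ℝ → ℝ
  | 0, f, x => f x
  | n + 1, f, x => p * binomialExp p n f (x + 1) + (1 - p) * binomialExp p n f x

theorem binomialExp_mono {p : ℝ} (h0 : 0 ≤ p) (h1 : p ≤ 1) {f g : ℝ → ℝ} (h : ∀ x, f x ≤ g x)
    (n : ℕ) (x : ℝ) : binomialExp p n f x ≤ binomialExp p n g x := by
  induction n generalizing x with
  | zero => exact h x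
  | succ n ih =>
    exact add_le_add (mul_le_mul_of_nonneg_left (ih _) h0)
      (mul_le_mul_of_nonneg_left (ih _) (sub_nonneg.2 h1))

theorem binomialExp_nonneg {p : ℝ} (h0 : 0 ≤ p) (h1 : p ≤ 1) {f : ℝ → ℝ} (h : ∀ x, 0 ≤ f x)
    (n : ℕ) (x : ℝ) : 0 ≤ binomialExp p n f x := by
  induction n generalizing x with
  | zero => exact h x
  | succ n ih =>
    exact add_nonneg (mul_nonneg h0 (ih _)) (mul_nonneg (sub_nonneg.2 h1) (ih _))

theorem binomialExp_zero_left (n : ℕ) (f : ℝ → ℝ) (x : ℝ) : binomialExp 0 n f x = f x := by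
  induction n generalizing x with
  | zero => rfl
  | succ n ih => simp [binomialExp, ih]

theorem binomialExp_one_sub_sq (p : ℝ) (n : ℕ) (a b x : ℝ) :
    binomialExp p n (fun y => 1 - b * (y - a) ^ 2) x
      = 1 - b * ((x + n * p - a) ^ 2 + n * (p * (1 - p))) := by
  induction n generalizing x with
  | zero => simp [binomialExp]
  | succ n ih =>
    simp only [binomialExp, ih]
    push_cast
    ring

/-- Change of measure between two binomial laws, by the Cauchy-Schwarz inequality. -/
theorem sq_binomialExp_le {p q : ℝ} (hp0 : 0 < p) (hp1 : p < 1) (f : ℝ → ℝ) (n : ℕ) (x : ℝ) :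
    binomialExp q n f x ^ 2
      ≤ (1 + (p - q) ^ 2 / (p * (1 - p))) ^ n * binomialExp p n (fun y => f y ^ 2) x := by
  have hp : 0 < 1 - p := sub_pos.2 hp1
  induction n generalizing x with
  | zero => simp [binomialExp]
  | succ n ih =>
    simp only [binomialExp]
    have key (u v : ℝ) : (q * u + (1 - q) * v) ^ 2
        ≤ (1 + (p - q) ^ 2 / (p * (1 - p))) * (p * u ^ 2 + (1 - p) * v ^ 2) := by
      -- The first factor equals `q²/p + (1-q)²/(1-p)`, so the Cauchy-Schwarz defect is a single
      -- square.
      have : (1 + (p - q) ^ 2 / (p * (1 - p))) * (p * u ^ 2 + (1 - p) * v ^ 2)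
          - (q * u + (1 - q) * v) ^ 2
          = (q * (1 - p) * v - (1 - q) * p * u) ^ 2 / (p * (1 - p)) := by
        field_simp
        ring
      have h2 : 0 ≤ (q * (1 - p) * v - (1 - q) * p * u) ^ 2 / (p * (1 - p)) := by positivity
      linarith
    refine (key _ _).trans ?_
    rw [pow_succ' (1 + (p - q) ^ 2 / (p * (1 - p))), mul_assoc]
    refine mul_le_mul_of_nonneg_left ?_ (by positivity)
    have h1 := mul_le_mul_of_nonneg_left (ih (x + 1)) hp0.le
    have h2 := mul_le_mul_of_nonneg_left (ih x) hp.le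
    linarith

/-- A binomial variable of mean `n * q` is with probability at least `3 / 4` at most
`n * θ`, when `θ` exceeds `q` by `1 / √n`, or `q = 0`. -/
theorem binomialExp_indicator_ge {q θ : ℝ} {n : ℕ} (hn : 0 < n) (hq0 : 0 ≤ q) (hq1 : q ≤ 1)
    (hθ : 0 ≤ θ) (h : q = 0 ∨ q + 1 / √(n : ℝ) ≤ θ) :
    3 / 4 ≤ binomialExp q n (fun y => if y ≤ θ * n then 1 else 0) 0 := by
  have hn' : (0 : ℝ) < n := Nat.cast_pos.2 hn
  rcases h with rfl | h
  · rw [binomialExp_zero_left, if_pos (by positivity)]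
    norm_num
  · have hs : 0 < √(n : ℝ) := Real.sqrt_pos.2 hn'
    have hss : √(n : ℝ) * √(n : ℝ) = n := Real.mul_self_sqrt hn'.le
    -- Chebyshev: a parabola lies below the indicator, and its expectation is exactly `1 - q(1-q)`.
    have := binomialExp_mono hq0 hq1 (f := fun y => 1 - (1 / (n : ℝ)) * (y - n * q) ^ 2)
      (g := fun y => if y ≤ θ * n then 1 else 0) (fun y => by
        split_ifs with hy
        · have : 0 ≤ (1 / (n : ℝ)) * (y - n * q) ^ 2 := by positivity
          linarith
        · rw [not_le] at hy
          have h1 : √(n : ℝ) ≤ y - n * q := by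
            have h2 := mul_le_mul_of_nonneg_right h hn'.le
            have h3 : 1 / √(n : ℝ) * n = √(n : ℝ) := by
              rw [one_div, inv_mul_eq_div, div_eq_iff hs.ne', hss]
            linarith
          have h4 : (n : ℝ) ≤ (y - n * q) ^ 2 := by
            calc (n : ℝ) = √(n : ℝ) ^ 2 := by rw [sq, hss]
              _ ≤ _ := pow_le_pow_left₀ hs.le h1 2
          have h5 : 1 ≤ (1 / (n : ℝ)) * (y - n * q) ^ 2 := by
            rw [one_div, inv_mul_eq_div, le_div_iff₀ hn']
            linarith
          linarith) n 0
    refine le_trans ?_ this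
    rw [binomialExp_one_sub_sq]
    have : 1 / (n : ℝ) * ((0 + n * q - n * q) ^ 2 + n * (q * (1 - q))) = q * (1 - q) := by
      field_simp
      ring
    rw [this]
    nlinarith [sq_nonneg (q - 1 / 2)]

/-- A lower bound on the lower tail of a binomial law. -/
theorem binomialExp_lower_tail {p θ : ℝ} {n : ℕ} (hn : 0 < n) (hp0 : 0 < p) (hp1 : p < 1)
    (hθ : 0 ≤ θ) (hθp : θ ≤ p) :
    9 / 16 * Real.exp (-((2 * n * (p - θ) ^ 2 + 2) / (p * (1 - p))))
      ≤ binomialExp p n (fun y => if y ≤ θ * n then 1 else 0) 0 := by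
  have hn' : (0 : ℝ) < n := Nat.cast_pos.2 hn
  have hs : 0 < √(n : ℝ) := Real.sqrt_pos.2 hn'
  have hss : √(n : ℝ) ^ 2 = n := Real.sq_sqrt hn'.le
  have hpp : 0 < p * (1 - p) := mul_pos hp0 (sub_pos.2 hp1)
  set r : ℝ := 1 / √(n : ℝ) with hr
  have hr0 : 0 < r := by positivity
  have hr2 : n * r ^ 2 = 1 := by
    rw [hr, div_pow, hss]
    field_simp
  -- The tilted mean lies `1/√n` below `θ`, so that Chebyshev applies; if truncated to `0`, the sum
  -- is identically `0`.
  set q : ℝ := max 0 (θ - r) with hq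
  have hq0 : 0 ≤ q := le_max_left _ _
  have hqθ : q ≤ θ := max_le hθ (by linarith)
  have hqr : θ - r ≤ q := le_max_right _ _
  have h1 : 3 / 4 ≤ binomialExp q n (fun y => if y ≤ θ * n then 1 else 0) 0 := by
    refine binomialExp_indicator_ge hn hq0 (by linarith) hθ ?_
    rcases max_choice 0 (θ - r) with h | h
    · exact Or.inl h
    · right
      rw [hq, h]
      linarith
  have h2 := sq_binomialExp_le (q := q) hp0 hp1 (fun y => if y ≤ θ * n then (1 : ℝ) else 0) n 0
  have hsq : (fun y : ℝ => (if y ≤ θ * n then (1 : ℝ) else 0) ^ 2)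
      = fun y => if y ≤ θ * n then 1 else 0 := by
    funext y
    split_ifs <;> simp
  rw [hsq] at h2
  set P := binomialExp p n (fun y => if y ≤ θ * n then (1 : ℝ) else 0) 0 with hP
  have hP0 : 0 ≤ P := binomialExp_nonneg hp0.le hp1.le
    (fun y => by split_ifs <;> norm_num) n 0
  have h3 : (9 / 16 : ℝ) ≤ (1 + (p - q) ^ 2 / (p * (1 - p))) ^ n * P := by
    refine le_trans ?_ h2
    calc (9 / 16 : ℝ) = (3 / 4) ^ 2 := by norm_num
      _ ≤ _ := pow_le_pow_left₀ (by norm_num) h1 2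
  have h4 : (1 + (p - q) ^ 2 / (p * (1 - p))) ^ n
      ≤ Real.exp ((2 * n * (p - θ) ^ 2 + 2) / (p * (1 - p))) := by
    have h5 : 1 + (p - q) ^ 2 / (p * (1 - p)) ≤ Real.exp ((p - q) ^ 2 / (p * (1 - p))) := by
      linarith [Real.add_one_le_exp ((p - q) ^ 2 / (p * (1 - p)))]
    refine (pow_le_pow_left₀ (by positivity) h5 n).trans ?_
    rw [← Real.exp_nat_mul, Real.exp_le_exp, ← mul_div_assoc]
    refine div_le_div_of_nonneg_right ?_ hpp.le
    have h6 : (p - q) ^ 2 ≤ (p - θ + r) ^ 2 := pow_le_pow_left₀ (by linarith) (by linarith) 2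
    have h7 : (p - θ + r) ^ 2 ≤ 2 * (p - θ) ^ 2 + 2 * r ^ 2 := by
      nlinarith [sq_nonneg (p - θ - r)]
    calc (n : ℝ) * (p - q) ^ 2 ≤ n * (2 * (p - θ) ^ 2 + 2 * r ^ 2) :=
          mul_le_mul_of_nonneg_left (h6.trans h7) hn'.le
      _ = 2 * n * (p - θ) ^ 2 + 2 * (n * r ^ 2) := by ring
      _ = _ := by rw [hr2]; ring
  rw [Real.exp_neg, ← div_eq_mul_inv, div_le_iff₀ (Real.exp_pos _), mul_comm]
  exact h3.trans (mul_le_mul_of_nonneg_right h4 hP0)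

/-! ### Survival of a random walk with positive drift. -/

/-- A lower bound on the probability that a random walk at height `w` never becomes
nonpositive. -/
noncomputable def survival (lam w : ℝ) : ℝ := max 0 (1 - Real.exp (-(lam * w)))

theorem survival_nonneg (lam w : ℝ) : 0 ≤ survival lam w := le_max_left _ _

theorem survival_le_one (lam w : ℝ) : survival lam w ≤ 1 :=
  max_le zero_le_one (by linarith [Real.exp_pos (-(lam * w))])

theorem survival_of_nonpos {lam w : ℝ} (hl : 0 ≤ lam) (hw : w ≤ 0) : survival lam w = 0 := by
  refine max_eq_left ?_
  have : 1 ≤ Real.exp (-(lam * w)) :=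
    Real.one_le_exp (neg_nonneg.2 (mul_nonpos_of_nonneg_of_nonpos hl hw))
  linarith

theorem exp_neg_le_quadratic {x : ℝ} (hx : 0 ≤ x) : Real.exp (-x) ≤ 1 - x + x ^ 2 / 2 := by
  have h := Real.quadratic_le_exp_of_nonneg hx
  rw [Real.exp_neg, inv_le_iff_one_le_mul₀ (Real.exp_pos x)]
  have h1 : 0 < 1 - x + x ^ 2 / 2 := by nlinarith [sq_nonneg (x - 1)]
  have h2 : 1 ≤ (1 - x + x ^ 2 / 2) * (1 + x + x ^ 2 / 2) := by nlinarith [sq_nonneg (x ^ 2)]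
  exact h2.trans (mul_le_mul_of_nonneg_left h h1.le)

/-- `survival` is a subsolution for the walk with steps `X - θ`, with `X` Bernoulli of mean
`p`. -/
theorem survival_step {p θ lam : ℝ} (h0 : 0 ≤ p) (h1 : p ≤ 1) (hl : 0 ≤ lam)
    (hlam : lam ≤ 2 * (p - θ)) (w : ℝ) :
    survival lam w ≤ p * survival lam (w + 1 - θ) + (1 - p) * survival lam (w - θ) := by
  have hA := le_max_right 0 (1 - Real.exp (-(lam * (w + 1 - θ))))
  have hB := le_max_right 0 (1 - Real.exp (-(lam * (w - θ))))
  have hA0 := survival_nonneg lam (w + 1 - θ)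
  have hB0 := survival_nonneg lam (w - θ)
  refine max_le (add_nonneg (mul_nonneg h0 hA0) (mul_nonneg (sub_nonneg.2 h1) hB0)) ?_
  have eA : Real.exp (-(lam * (w + 1 - θ)))
      = Real.exp (-(lam * w)) * (Real.exp (lam * θ) * Real.exp (-lam)) := by
    rw [← Real.exp_add, ← Real.exp_add]
    ring_nf
  have eB : Real.exp (-(lam * (w - θ))) = Real.exp (-(lam * w)) * Real.exp (lam * θ) := by
    rw [← Real.exp_add]
    ring_nf
  -- This says that `exp (-lam * w)` is a supermartingale; the quadratic term `p * lam² / 2` is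
  -- absorbed by the drift because `lam ≤ 2 * (p - θ)`.
  have hmgf : Real.exp (lam * θ) * (1 - p + p * Real.exp (-lam)) ≤ 1 := by
    have h2 : 1 - p + p * Real.exp (-lam) ≤ Real.exp (-(lam * θ)) := by
      have h3 := mul_le_mul_of_nonneg_left (exp_neg_le_quadratic hl) h0
      have h4 := Real.add_one_le_exp (-(lam * θ))
      have h5 : lam * (p * lam) ≤ lam * (2 * (p - θ)) :=
        mul_le_mul_of_nonneg_left ((mul_le_of_le_one_left hl h1).trans hlam) hl
      nlinarith
    calc _ ≤ Real.exp (lam * θ) * Real.exp (-(lam * θ)) :=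
          mul_le_mul_of_nonneg_left h2 (Real.exp_pos _).le
      _ = 1 := by rw [← Real.exp_add]; simp
  have h6 := mul_le_mul_of_nonneg_left hmgf (Real.exp_pos (-(lam * w))).le
  have h7 := mul_le_mul_of_nonneg_left hA h0
  have h8 := mul_le_mul_of_nonneg_left hB (sub_nonneg.2 h1)
  rw [eA] at h7
  rw [eB] at h8
  simp only [survival] at *
  rw [eA, eB]
  nlinarith

theorem survival_le_binomialExp {p θ lam : ℝ} (h0 : 0 ≤ p) (h1 : p ≤ 1) (hl : 0 ≤ lam)
    (hlam : lam ≤ 2 * (p - θ)) (n : ℕ) (m x : ℝ) :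
    survival lam (x - θ * m)
      ≤ binomialExp p n (fun y => survival lam (y - θ * (m + n))) x := by
  induction n generalizing x m with
  | zero => simp [binomialExp]
  | succ n ih =>
    refine (survival_step h0 h1 hl hlam _).trans ?_
    have hA := ih (m + 1) (x + 1)
    have hB := ih (m + 1) x
    have e : m + 1 + (n : ℝ) = m + ((n + 1 : ℕ) : ℝ) := by push_cast; ring
    rw [e] at hA hB
    have eA : x - θ * m + 1 - θ = x + 1 - θ * (m + 1) := by ring
    have eB : x - θ * m - θ = x - θ * (m + 1) := by ring
    rw [eA, eB]
    exact add_le_add (mul_le_mul_of_nonneg_left hA h0)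
      (mul_le_mul_of_nonneg_left hB (sub_nonneg.2 h1))

/-- At height `0` the survival bound is zero, so the first sample is required to be a success: this
costs a factor `p` and lifts the walk to `1 - θ`. -/
theorem binomialExp_survival_ge {p θ lam : ℝ} (h0 : 0 ≤ p) (h1 : p ≤ 1) (hl : 0 ≤ lam)
    (hlam : lam ≤ 2 * (p - θ)) {n : ℕ} (hn : 0 < n) :
    p * survival lam (1 - θ) ≤ binomialExp p n (fun y => survival lam (y - θ * n)) 0 := by
  obtain ⟨k, rfl⟩ := Nat.exists_eq_succ_of_ne_zero hn.ne'
  have hA := survival_le_binomialExp h0 h1 hl hlam k 1 1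
  have e : 1 + (k : ℝ) = ((k + 1 : ℕ) : ℝ) := by push_cast; ring
  rw [e, mul_one] at hA
  have hB := binomialExp_nonneg h0 h1
    (fun y => survival_nonneg lam (y - θ * ((k + 1 : ℕ) : ℝ))) k 0
  have h2 := mul_le_mul_of_nonneg_left hA h0
  have h3 := mul_nonneg (sub_nonneg.2 h1) hB
  simp only [binomialExp, Nat.succ_eq_add_one, zero_add]
  linarith

/-! ### Sample lists, stuck histories and the potential. -/

/-- The total reward of a list of data points. -/
noncomputable def rewardSum (l : List DataPoint) : ℝ := (l.map fun x => rewardValue x.2).sum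

/-- Only the total reward of the initial samples matters, so their law can be replaced by a binomial
one; `hG` is required only for lists that can occur. -/
theorem binomialExp_le_pmfExp_sampleArm (p : unitInterval) (a : Fin 2) (n : ℕ) {f : ℝ → ℝ}
    (hf : ∀ x, 0 ≤ f x) (x : ℝ) (G : List DataPoint → ℝ≥0∞)
    (hG : ∀ l : List DataPoint, l.length = n → (∀ y ∈ l, y.1 = a) →
      ENNReal.ofReal (f (x + rewardSum l)) ≤ G l) :
    ENNReal.ofReal (binomialExp p n f x) ≤ pmfExp (sampleArm p a n) G := by
  induction n generalizing x G with
  | zero => simpa [sampleArm, pmfExp_pure, binomialExp, rewardSum] using hG []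
  | succ n ih =>
    have h0 : (0 : ℝ) ≤ p := p.2.1
    have h1 : (0 : ℝ) ≤ 1 - p := sub_nonneg.2 p.2.2
    have hb (y : ℝ) := binomialExp_nonneg h0 p.2.2 hf n y
    simp only [sampleArm, binomialExp, pmfExp_bind, pmfExp_pure, pmfExp_rewardLaw]
    rw [ENNReal.ofReal_add (mul_nonneg h0 (hb _)) (mul_nonneg h1 (hb _)),
      ENNReal.ofReal_mul h0, ENNReal.ofReal_mul h1]
    refine add_le_add (mul_le_mul_right (ih _ _ fun l hl hla => ?_) _)
      (mul_le_mul_right (ih _ _ fun l hl hla => ?_) _)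
    · have := hG ((a, true) :: l) (by simp [hl]) (by simpa using hla)
      simpa [rewardSum, rewardValue, add_assoc] using this
    · have := hG ((a, false) :: l) (by simp [hl]) (by simpa using hla)
      simpa [rewardSum, rewardValue, add_assoc] using this

theorem filter_arm_eq_self {l : List DataPoint} {a : Fin 2} (h : ∀ x ∈ l, x.1 = a) :
    l.filter (fun x => x.1 = a) = l :=
  List.filter_eq_self.2 fun x hx => by simpa using h x hx

theorem filter_arm_eq_nil {l : List DataPoint} {a b : Fin 2} (hab : a ≠ b)
    (h : ∀ x ∈ l, x.1 = a) : l.filter (fun x => x.1 = b) = [] :=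
  List.filter_eq_nil_iff.2 fun x hx => by simpa [h x hx] using hab

/-- The total reward of arm `a` in the history, including the initial data. -/
noncomputable def History.armSum (h : History) (a : Fin 2) : ℝ :=
  rewardSum (h.data.filter (fun x => x.1 = a))

theorem History.avg_eq (h : History) (a : Fin 2) : h.avg a = h.armSum a / h.count a := rfl

/-- The histories with `N` samples of arm `1`, all of them initial and of average at most `θ`,
and at least `N` samples of arm `2`. -/
structure History.IsStuck (N : ℕ) (θ : ℝ) (h : History) : Prop where
  rounds_eq : ∀ x ∈ h.rounds, x.1 = arm2
  count_one : h.count arm1 = N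
  le_count_two : N ≤ h.count arm2
  armSum_one_le : h.armSum arm1 ≤ θ * N

/-- The history after one more data point. -/
def History.push (h : History) (x : DataPoint) : History :=
  { initial := h.initial, rounds := h.rounds ++ [x] }

theorem History.push_data (h : History) (x : DataPoint) : (h.push x).data = h.data ++ [x] := by
  simp [History.push, History.data]

theorem History.IsStuck.push {N : ℕ} {θ : ℝ} {h : History} (hh : h.IsStuck N θ) (r : Bool) :
    (h.push (arm2, r)).IsStuck N θ where
  rounds_eq x hx := by
    rcases List.mem_append.1 hx with hx | hx
    · exact hh.rounds_eq x hx
    · rw [List.mem_singleton.1 hx]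
  count_one := by
    rw [← hh.count_one]
    simp [History.count, History.push_data]
  le_count_two := by
    refine hh.le_count_two.trans ?_
    simp [History.count, History.push_data]
  armSum_one_le := by
    refine le_trans (le_of_eq ?_) hh.armSum_one_le
    simp [History.armSum, History.push_data]

theorem History.push_count_two (h : History) (r : Bool) :
    (h.push (arm2, r)).count arm2 = h.count arm2 + 1 := by
  simp [History.count, History.push_data]

theorem History.push_armSum_two (h : History) (r : Bool) :
    (h.push (arm2, r)).armSum arm2 = h.armSum arm2 + rewardValue r := by
  simp [History.armSum, History.push_data, rewardSum]

/-- A lower bound on the probability that, given the history `h`, arm `1` is never chosen. -/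
noncomputable def History.potential (N : ℕ) (θ lam : ℝ) (h : History) : ℝ≥0∞ :=
  open Classical in
  if h.IsStuck N θ then
    ENNReal.ofReal (survival lam (h.armSum arm2 - θ * h.count arm2)) else 0

theorem History.potential_le_one (N : ℕ) (θ lam : ℝ) (h : History) :
    h.potential N θ lam ≤ 1 := by
  unfold History.potential
  split_ifs
  · exact ENNReal.ofReal_le_one.2 (survival_le_one _ _)
  · exact zero_le_one

theorem History.potential_eq_zero {N : ℕ} {θ lam : ℝ} {h : History}
    (hh : h ∉ samplingFailure 0) : h.potential N θ lam = 0 := by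
  refine if_neg fun hs => hh ?_
  have : h.rounds.filter (fun x => x.1 ≠ arm2) = [] :=
    List.filter_eq_nil_iff.2 fun x hx => by simp [hs.rounds_eq x hx]
  change (h.rounds.filter (fun x => x.1 ≠ arm2)).length ≤ 0
  rw [this]
  rfl

theorem chooseArm_eq_pure {v : Fin 2 → ℝ} (h : v arm1 < v arm2) :
    chooseArm v = PMF.pure arm2 := by
  have hb : bestArms v = {arm2} := by
    ext a
    fin_cases a
    · simpa [bestArms] using h
    · simpa [bestArms] using h.le
  ext a
  simp [chooseArm, hb, PMF.uniformOfFinset_apply, PMF.pure_apply]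

/-- A pessimistic agent who sees a small number of bad samples of arm `1` and better samples of
arm `2` prefers arm `2`. -/
theorem History.IsStuck.lcb_lt {N : ℕ} {θ η : ℝ} {h : History} (hh : h.IsStuck N θ)
    (hN : 0 < N) (hη : 0 ≤ η) (hθ : √(η / N) < θ)
    (h2 : θ * h.count arm2 < h.armSum arm2) : h.lcb η arm1 < h.lcb η arm2 := by
  have hN' : (0 : ℝ) < N := Nat.cast_pos.2 hN
  have hn2 : (N : ℝ) ≤ h.count arm2 := Nat.cast_le.2 hh.le_count_two
  have ha1 : h.avg arm1 ≤ θ := by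
    rw [History.avg_eq, hh.count_one, div_le_iff₀ hN']
    exact hh.armSum_one_le
  have ha2 : θ < h.avg arm2 := by
    rwa [History.avg_eq, lt_div_iff₀ (hN'.trans_le hn2)]
  have hs : √(η / h.count arm2) ≤ √(η / N) :=
    Real.sqrt_le_sqrt (div_le_div_of_nonneg_left hη hN' hn2)
  unfold History.lcb
  rw [hh.count_one]
  -- The first inequality excludes a tie at `0`: the average of arm 2 exceeds `θ`, which exceeds its
  -- deduction.
  exact lt_max_of_lt_right (max_lt (by linarith) (by linarith))

theorem potential_le_pmfExp_playRound {μ : Fin 2 → unitInterval} {N : ℕ} {θ lam η : ℝ}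
    {ind : IndexRule} (hind : IsPessimistic η ind) (hN : 0 < N) (hη : 0 ≤ η)
    (hθ : √(η / N) < θ) (hl : 0 ≤ lam) (hlam : lam ≤ 2 * ((μ arm2 : ℝ) - θ)) (h : History) :
    h.potential N θ lam ≤ pmfExp (playRound μ ind h) (History.potential N θ lam) := by
  by_cases hh : h.IsStuck N θ
  swap
  · rw [History.potential, if_neg hh]
    exact zero_le
  -- Where arm 2 might lose, the potential is already zero; elsewhere the choice is deterministic
  -- and `survival_step` applies.
  by_cases hw : h.armSum arm2 - θ * h.count arm2 ≤ 0
  · rw [History.potential, if_pos hh, survival_of_nonpos hl hw, ENNReal.ofReal_zero]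
    exact zero_le
  rw [not_le, sub_pos] at hw
  have hc : chooseArm (ind h) = PMF.pure arm2 := by
    refine chooseArm_eq_pure ?_
    rw [hind h, hind h]
    exact hh.lcb_lt hN hη hθ hw
  have h0 : (0 : ℝ) ≤ μ arm2 := (μ arm2).2.1
  have h1 : (0 : ℝ) ≤ 1 - μ arm2 := sub_nonneg.2 (μ arm2).2.2
  have hpush (r : Bool) : (h.push (arm2, r)).potential N θ lam
      = ENNReal.ofReal (survival lam
        (h.armSum arm2 - θ * h.count arm2 + rewardValue r - θ)) := by
    rw [History.potential, if_pos (hh.push r), h.push_count_two, h.push_armSum_two]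
    push_cast
    ring_nf
  have hE : pmfExp (playRound μ ind h) (History.potential N θ lam)
      = ENNReal.ofReal (μ arm2) * (h.push (arm2, true)).potential N θ lam
        + ENNReal.ofReal (1 - μ arm2) * (h.push (arm2, false)).potential N θ lam := by
    simp only [playRound, hc, pmfExp_bind, pmfExp_pure, pmfExp_rewardLaw, History.push]
  rw [hE, hpush, hpush, ← ENNReal.ofReal_mul h0, ← ENNReal.ofReal_mul h1,
    ← ENNReal.ofReal_add (mul_nonneg h0 (survival_nonneg _ _))
      (mul_nonneg h1 (survival_nonneg _ _)), History.potential, if_pos hh]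
  refine ENNReal.ofReal_le_ofReal ?_
  have := survival_step h0 (μ arm2).2.2 hl hlam (h.armSum arm2 - θ * h.count arm2)
  simpa [rewardValue] using this

theorem pmfExp_potential_mono {μ : Fin 2 → unitInterval} {N T : ℕ} {θ lam : ℝ} {ηs : ℕ → ℝ}
    {agents : ℕ → IndexRule} (N₀ : ℕ)
    (hag : ∀ t ∈ Set.Icc 1 T, 0 ≤ ηs t ∧ IsPessimistic (ηs t) (agents t) ∧ √(ηs t / N) < θ)
    (hN : 0 < N) (hl : 0 ≤ lam) (hlam : lam ≤ 2 * ((μ arm2 : ℝ) - θ)) :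
    pmfExp (initialLaw μ N₀) (History.potential N θ lam)
      ≤ pmfExp (protocolLaw μ N₀ agents T) (History.potential N θ lam) := by
  induction T with
  | zero => exact le_rfl
  | succ T ih =>
    refine (ih fun t ht => hag t ⟨ht.1, ht.2.trans T.le_succ⟩).trans ?_
    obtain ⟨h1, h2, h3⟩ := hag (T + 1) ⟨Nat.le_add_left 1 T, le_rfl⟩
    rw [protocolLaw, pmfExp_bind]
    exact pmfExp_mono _ fun h => potential_le_pmfExp_playRound h2 hN h1 h3 hl hlam h

theorem potential_initial {N : ℕ} {θ lam : ℝ} {l₁ l₂ : List DataPoint}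
    (hl1 : l₁.length = N) (ha1 : ∀ x ∈ l₁, x.1 = arm1)
    (hl2 : l₂.length = N) (ha2 : ∀ x ∈ l₂, x.1 = arm2) :
    History.potential N θ lam { initial := l₁ ++ l₂, rounds := [] }
      = ENNReal.ofReal (if rewardSum l₁ ≤ θ * N then 1 else 0)
        * ENNReal.ofReal (survival lam (rewardSum l₂ - θ * N)) := by
  have e1 : (l₁ ++ l₂ ++ []).filter (fun x => x.1 = arm1) = l₁ := by
    rw [List.append_nil, List.filter_append, filter_arm_eq_self ha1,
      filter_arm_eq_nil (by decide) ha2, List.append_nil]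
  have e2 : (l₁ ++ l₂ ++ []).filter (fun x => x.1 = arm2) = l₂ := by
    rw [List.append_nil, List.filter_append, filter_arm_eq_self ha2,
      filter_arm_eq_nil (by decide) ha1, List.nil_append]
  have hiff : History.IsStuck N θ { initial := l₁ ++ l₂, rounds := [] }
      ↔ rewardSum l₁ ≤ θ * N := by
    constructor
    · intro h
      have := h.armSum_one_le
      rwa [History.armSum, History.data, e1] at this
    · intro h
      refine ⟨by simp, ?_, ?_, ?_⟩
      · rw [History.count, History.data, e1, hl1]
      · rw [History.count, History.data, e2, hl2]
      · rwa [History.armSum, History.data, e1]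
  unfold History.potential
  by_cases h : rewardSum l₁ ≤ θ * N
  · rw [if_pos (hiff.2 h), if_pos h, ENNReal.ofReal_one, one_mul, History.armSum,
      History.count, History.data, e2, hl2]
  · rw [if_neg (mt hiff.1 h), if_neg h, ENNReal.ofReal_zero, zero_mul]

/-! ### From the initial samples to the failure probability. -/

theorem pmfExp_initialLaw_ge (μ : Fin 2 → unitInterval) (N : ℕ) (θ lam : ℝ) :
    ENNReal.ofReal (binomialExp (μ arm1) N (fun y => if y ≤ θ * N then 1 else 0) 0
        * binomialExp (μ arm2) N (fun y => survival lam (y - θ * N)) 0)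
      ≤ pmfExp (initialLaw μ N) (History.potential N θ lam) := by
  have hi (y : ℝ) : (0 : ℝ) ≤ if y ≤ θ * N then 1 else 0 := by split_ifs <;> norm_num
  have hs0 := binomialExp_nonneg (μ arm2).2.1 (μ arm2).2.2
    (fun y => survival_nonneg lam (y - θ * N)) N 0
  have hc (k : ℝ) (n : ℕ) (f : ℝ → ℝ) (x p : ℝ) :
      binomialExp p n (fun y => f y * k) x = binomialExp p n f x * k := by
    induction n generalizing x with
    | zero => rfl
    | succ n ih =>
      simp only [binomialExp, ih]
      ring
  -- Independence of the arms: the product becomes a nested expectation, evaluated one arm at a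
  -- time.
  rw [← hc]
  simp only [initialLaw, pmfExp_bind, pmfExp_pure]
  refine binomialExp_le_pmfExp_sampleArm _ _ _ (fun x => mul_nonneg (hi x) hs0) _ _
    fun l₁ hl1 ha1 => ?_
  rw [zero_add, mul_comm, ← hc]
  refine binomialExp_le_pmfExp_sampleArm _ _ _
    (fun x => mul_nonneg (survival_nonneg _ _) (hi _)) _ _ fun l₂ hl2 ha2 => ?_
  rw [potential_initial hl1 ha1 hl2 ha2, zero_add, mul_comm, ENNReal.ofReal_mul (hi _)]

theorem failureProb_ge {μ : Fin 2 → unitInterval} {N T : ℕ} {θ lam : ℝ} {ηs : ℕ → ℝ}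
    {agents : ℕ → IndexRule}
    (hag : ∀ t ∈ Set.Icc 1 T, 0 ≤ ηs t ∧ IsPessimistic (ηs t) (agents t) ∧ √(ηs t / N) < θ)
    (hN : 0 < N) (hl : 0 ≤ lam) (hlam : lam ≤ 2 * ((μ arm2 : ℝ) - θ)) :
    binomialExp (μ arm1) N (fun y => if y ≤ θ * N then 1 else 0) 0
        * binomialExp (μ arm2) N (fun y => survival lam (y - θ * N)) 0
      ≤ failureProb μ N agents T 0 := by
  have h := (pmfExp_initialLaw_ge μ N θ lam).trans
    ((pmfExp_potential_mono N hag hN hl hlam).trans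
      (pmfExp_le_toMeasure _ (s := samplingFailure 0) trivial
        (History.potential_le_one N θ lam) fun _ => History.potential_eq_zero))
  exact (ENNReal.ofReal_le_iff_le_toReal (MeasureTheory.measure_ne_top _ _)).1 h

/-! ### Regret from failure. -/

theorem length_rounds_of_mem_support {μ : Fin 2 → unitInterval} {N T : ℕ}
    {agents : ℕ → IndexRule} {h : History} (hh : h ∈ (protocolLaw μ N agents T).support) :
    h.rounds.length = T := by
  induction T generalizing h with
  | zero =>
    simp only [protocolLaw, initialLaw, PMF.mem_support_bind_iff, PMF.mem_support_pure_iff] at hh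
    obtain ⟨_, _, _, _, rfl⟩ := hh
    rfl
  | succ T ih =>
    simp only [protocolLaw, playRound, PMF.mem_support_bind_iff, PMF.mem_support_pure_iff] at hh
    obtain ⟨h', hh', _, _, _, _, rfl⟩ := hh
    simp [ih hh']

theorem ae_length_rounds (μ : Fin 2 → unitInterval) (N T : ℕ) (agents : ℕ → IndexRule) :
    ∀ᵐ h ∂(protocolLaw μ N agents T).toMeasure, h.rounds.length = T := by
  have hm : MeasurableSet {h : History | ¬h.rounds.length = T} := trivial
  rw [MeasureTheory.ae_iff, PMF.toMeasure_apply_eq_zero_iff _ hm, Set.disjoint_left]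
  exact fun h hh => not_not.2 (length_rounds_of_mem_support hh)

theorem sum_map_mean_le (μ : Fin 2 → unitInterval) (hμ : (μ arm2 : ℝ) ≤ μ arm1)
    (l : List DataPoint) : (l.map fun x => (μ x.1 : ℝ)).sum ≤ μ arm1 * l.length := by
  have h (a : Fin 2) : (μ a : ℝ) ≤ μ arm1 := by
    fin_cases a
    · exact le_rfl
    · exact hμ
  have := List.sum_le_card_nsmul (l.map fun x => (μ x.1 : ℝ)) (μ arm1 : ℝ) (by
    intro x hx
    obtain ⟨y, _, rfl⟩ := List.mem_map.1 hx
    exact h _)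
  rw [List.length_map, nsmul_eq_mul, mul_comm] at this
  exact this

theorem sum_map_mean_of_failure (μ : Fin 2 → unitInterval) {h : History}
    (hh : h ∈ samplingFailure 0) :
    (h.rounds.map fun x => (μ x.1 : ℝ)).sum = μ arm2 * h.rounds.length := by
  have hall : ∀ x ∈ h.rounds, x.1 = arm2 := by
    have h0 : h.rounds.filter (fun x => x.1 ≠ arm2) = [] :=
      List.length_eq_zero_iff.1 (Nat.le_zero.1 hh)
    intro x hx
    simpa using List.filter_eq_nil_iff.1 h0 x hx
  have : (h.rounds.map fun x => (μ x.1 : ℝ)) = h.rounds.map fun _ => (μ arm2 : ℝ) :=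
    List.map_congr_left fun x hx => by rw [hall x hx]
  rw [this, List.map_const', List.sum_replicate, nsmul_eq_mul, mul_comm]

theorem regret_ge (μ : Fin 2 → unitInterval) (hμ : (μ arm2 : ℝ) ≤ μ arm1) (N T : ℕ)
    (agents : ℕ → IndexRule) :
    ((μ arm1 : ℝ) - μ arm2) * T * failureProb μ N agents T 0 ≤ regret μ N agents T := by
  set ν := (protocolLaw μ N agents T).toMeasure with hν
  set f : History → ℝ := fun h => (h.rounds.map (fun x => (μ x.1 : ℝ))).sum with hf
  -- An almost sure upper bound for the collected mean reward, attained on the failure event.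
  set g : History → ℝ := fun h => (μ arm1 : ℝ) * T
    - (samplingFailure 0).indicator (fun _ => ((μ arm1 : ℝ) - μ arm2) * T) h with hg
  have hms : MeasurableSet (samplingFailure 0) := trivial
  have hlen := ae_length_rounds μ N T agents
  have hf0 (h : History) : 0 ≤ f h := by
    refine List.sum_nonneg fun x hx => ?_
    obtain ⟨y, _, rfl⟩ := List.mem_map.1 hx
    exact (μ y.1).2.1
  have hfi : MeasureTheory.Integrable f ν := by
    refine MeasureTheory.Integrable.of_bound (C := (μ arm1 : ℝ) * T)
      (measurable_from_top.aestronglyMeasurable) ?_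
    filter_upwards [hlen] with h hh
    rw [Real.norm_of_nonneg (hf0 h)]
    have := sum_map_mean_le μ hμ h.rounds
    rwa [hh] at this
  have hii : MeasureTheory.Integrable
      ((samplingFailure 0).indicator fun _ => ((μ arm1 : ℝ) - μ arm2) * T) ν :=
    (MeasureTheory.integrable_const _).indicator hms
  have hle : ∫ h, f h ∂ν ≤ ∫ h, g h ∂ν := by
    refine MeasureTheory.integral_mono_ae hfi
      ((MeasureTheory.integrable_const _).sub hii) ?_
    filter_upwards [hlen] with h hh
    by_cases hs : h ∈ samplingFailure 0
    · simp only [hg, hf, Set.indicator_of_mem hs]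
      rw [sum_map_mean_of_failure μ hs, hh]
      linarith
    · simp only [hg, hf, Set.indicator_of_notMem hs]
      have := sum_map_mean_le μ hμ h.rounds
      rw [hh] at this
      linarith
  have hgi : ∫ h, g h ∂ν
      = (μ arm1 : ℝ) * T - ((μ arm1 : ℝ) - μ arm2) * T * failureProb μ N agents T 0 := by
    rw [hg, MeasureTheory.integral_sub (MeasureTheory.integrable_const _) hii,
      MeasureTheory.integral_indicator_const _ hms]
    simp [failureProb, ← hν, mul_comm]
  rw [regret, max_eq_left hμ]
  linarith

/-! ### Choice of the constants. -/

theorem half_le_one_sub_exp_neg {x : ℝ} (h0 : 0 ≤ x) (h1 : x ≤ 1) :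
    x / 2 ≤ 1 - Real.exp (-x) := by
  nlinarith [exp_neg_le_quadratic h0]

theorem failureProb_ge_of_isPessimistic {c : ℝ} (hc0 : 0 < c) (hc1 : c < 1 / 2)
    {μ : Fin 2 → unitInterval} {N T : ℕ} {ηs : ℕ → ℝ} {η : ℝ} {agents : ℕ → IndexRule}
    (h2 : c < (μ arm2 : ℝ)) (h21 : (μ arm2 : ℝ) < μ arm1) (h1 : (μ arm1 : ℝ) < 1 - c)
    (hag : ∀ t ∈ Set.Icc 1 T, 0 ≤ ηs t ∧ IsPessimistic (ηs t) (agents t))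
    (hη : η ∈ upperBounds (ηs '' Set.Icc 1 T)) (hη0 : 0 ≤ η)
    (hN : 64 * η / c ^ 2 + 1 / c ≤ (N : ℝ)) :
    9 / 32 * c ^ 3 * Real.exp (-(4 / c)) * ((μ arm1 : ℝ) - μ arm2)
        * Real.exp (-(8 / c * (N * ((μ arm1 : ℝ) - μ arm2) ^ 2)))
      ≤ failureProb μ N agents T 0 := by
  have hNpos : (0 : ℝ) < N := by
    have : 0 < 1 / c := by positivity
    have : 0 ≤ 64 * η / c ^ 2 := by positivity
    linarith
  have hN0 : 0 < N := Nat.cast_pos.1 hNpos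
  set p : ℝ := (μ arm1 : ℝ) with hp
  set s : ℝ := (μ arm2 : ℝ) with hs
  set D : ℝ := p - s with hD
  have hD0 : 0 < D := by linarith
  have hD1 : D < 1 := by linarith
  -- The drift `s - θ = c * D / 2` permits `lam = c * D`, while `p - θ = (1 + c / 2) * D` is still
  -- of order `D`, as the tail bound needs.
  set θ : ℝ := s - c / 2 * D with hθdef
  have hcD : c * D ≤ c := mul_le_of_le_one_right hc0.le hD1.le
  have hcD0 : 0 < c * D := mul_pos hc0 hD0
  have hθ : c / 8 < θ := by
    rw [hθdef]
    linarith
  have hsqrt : ∀ t ∈ Set.Icc 1 T, √(ηs t / N) < θ := by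
    intro t ht
    refine lt_of_le_of_lt ?_ hθ
    have hle : ηs t ≤ η := hη ⟨t, ht, rfl⟩
    refine (Real.sqrt_le_left (by positivity)).2 ?_
    rw [div_le_iff₀ hNpos]
    have h3 : 64 * η / c ^ 2 ≤ N := by
      have : 0 < 1 / c := by positivity
      linarith
    rw [div_le_iff₀ (by positivity)] at h3
    nlinarith
  have hfail := failureProb_ge (μ := μ) (θ := θ) (lam := c * D)
    (fun t ht => ⟨(hag t ht).1, (hag t ht).2, hsqrt t ht⟩) hN0 hcD0.le
    (by rw [hθdef]; linarith)
  refine le_trans ?_ hfail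
  have hp0 : 0 < p := by linarith
  have hp1 : p < 1 := by linarith
  have htail := binomialExp_lower_tail (p := p) (θ := θ) hN0 hp0 hp1 (by linarith) (by
    rw [hθdef]
    linarith)
  have hsurv := binomialExp_survival_ge (p := s) (θ := θ) (lam := c * D) (by linarith)
    (μ arm2).2.2 hcD0.le (by rw [hθdef]; linarith) hN0
  have hA : 9 / 16 * (Real.exp (-(4 / c)) * Real.exp (-(8 / c * (N * D ^ 2))))
      ≤ binomialExp p N (fun y => if y ≤ θ * N then 1 else 0) 0 := by
    refine le_trans ?_ htail
    rw [← Real.exp_add]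
    refine mul_le_mul_of_nonneg_left (Real.exp_le_exp.2 ?_) (by norm_num)
    -- Both factors exceed `c`, and the larger is at least `1/2`.
    have hpp : c / 2 ≤ p * (1 - p) := by nlinarith
    have hpp0 : 0 < p * (1 - p) := by linarith [half_pos hc0]
    have hnum : 2 * N * (p - θ) ^ 2 + 2 ≤ 4 * (N * D ^ 2) + 2 := by
      have e : p - θ = (1 + c / 2) * D := by
        rw [hθdef, hD]
        ring
      have h5 : (1 + c / 2) ^ 2 ≤ 2 := by nlinarith
      have h6 : 0 ≤ (N : ℝ) * D ^ 2 := by positivity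
      rw [e, mul_pow]
      nlinarith
    have : (2 * N * (p - θ) ^ 2 + 2) / (p * (1 - p)) ≤ (4 * (N * D ^ 2) + 2) / (c / 2) :=
      div_le_div₀ (by positivity) hnum (by positivity) hpp
    have e : (4 * (N * D ^ 2) + 2) / (c / 2) = 8 / c * (N * D ^ 2) + 4 / c := by
      field_simp
      ring
    linarith
  have hB : c ^ 3 * D / 2 ≤ binomialExp s N (fun y => survival (c * D) (y - θ * N)) 0 := by
    refine le_trans ?_ hsurv
    have h5 : c * D * c / 2 ≤ survival (c * D) (1 - θ) := by
      have hx : c * D * c ≤ 1 := by nlinarith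
      refine (half_le_one_sub_exp_neg (by positivity) hx).trans
        (le_trans ?_ (le_max_right _ _))
      refine sub_le_sub_left (Real.exp_le_exp.2 (neg_le_neg ?_)) _
      refine mul_le_mul_of_nonneg_left ?_ hcD0.le
      rw [hθdef]
      linarith
    calc c ^ 3 * D / 2 = c * (c * D * c / 2) := by ring
      _ ≤ s * survival (c * D) (1 - θ) :=
        mul_le_mul h2.le h5 (by positivity) (by linarith)
  calc _ = 9 / 16 * (Real.exp (-(4 / c)) * Real.exp (-(8 / c * (N * D ^ 2))))
        * (c ^ 3 * D / 2) := by ring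
    _ ≤ _ := mul_le_mul hA hB (by positivity) (le_trans (by positivity) hA)

end BanditSocialLearning

open BanditSocialLearning in
theorem theorem3p6 (c : ℝ) (hc0 : 0 < c) (hc1 : c < 1 / 2) :
    ∃ C : ℝ, 0 < C ∧ ∃ K : ℝ, 0 < K ∧
      ∀ (μ : Fin 2 → unitInterval) (N₀ T : ℕ) (ηs : ℕ → ℝ) (η : ℝ) (agents : ℕ → IndexRule),
        c < (μ arm2 : ℝ) → (μ arm2 : ℝ) < (μ arm1 : ℝ) → (μ arm1 : ℝ) < 1 - c →
        (∀ t ∈ Set.Icc 1 T, 0 ≤ ηs t ∧ IsPessimistic (ηs t) (agents t)) →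
        IsGreatest (ηs '' Set.Icc 1 T) η →
        64 * η / c ^ 2 + 1 / c ≤ (N₀ : ℝ) →
        C * ((μ arm1 : ℝ) - (μ arm2 : ℝ)) *
            Real.exp (-(K * ((N₀ : ℝ) * ((μ arm1 : ℝ) - (μ arm2 : ℝ)) ^ 2)))
          ≤ failureProb μ N₀ agents T 0 ∧
        C * ((μ arm1 : ℝ) - (μ arm2 : ℝ)) ^ 2 * (T : ℝ) *
            Real.exp (-(K * ((N₀ : ℝ) * ((μ arm1 : ℝ) - (μ arm2 : ℝ)) ^ 2)))
          ≤ regret μ N₀ agents T := by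
  refine ⟨9 / 32 * c ^ 3 * Real.exp (-(4 / c)), by positivity, 8 / c, by positivity, ?_⟩
  intro μ N₀ T ηs η agents h2 h21 h1 hag hη hN
  -- The maximum is attained, so `Set.Icc 1 T` is nonempty; this is where `T ≥ 1` is encoded.
  have hη0 : 0 ≤ η := by
    obtain ⟨t, ht, rfl⟩ := hη.1
    exact (hag t ht).1
  have hfail := failureProb_ge_of_isPessimistic hc0 hc1 h2 h21 h1 hag hη.2 hη0 hN
  refine ⟨hfail, le_trans ?_ (regret_ge μ h21.le N₀ T agents)⟩
  have hDT : 0 ≤ ((μ arm1 : ℝ) - (μ arm2 : ℝ)) * T :=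
    mul_nonneg (sub_nonneg.2 h21.le) (Nat.cast_nonneg T)
  exact (le_of_eq (by ring)).trans (mul_le_mul_of_nonneg_left hfail hDT)
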